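/- An \emph{implication algebra} is a set $A$ with one binary operation $\to$ satisfying the equations $(x\to y)\to x\approx x$, $\;(x\to y)\to y\approx (y\to x)\to x$ and $\;x\to(y\to z)\approx y\to(x\to z)$. Let $\mathcal V$ be the variety of implication algebras, and let $F_{\mathcal V}:\mathrm{Set}\to\mathrm{Set}$ be its free-algebra functor, which sends a set $X$ to the underlying set of the implication algebra freely generated by $X$, and a map $f:X\to Y$ to the unique homomorphism $F_{\mathcal V}(X)\to F_{\mathcal V}(Y)$ extending $f$ on the generators. \textbf{Corollary.} The variety $\mathcal V$ is congruence $3$-permutable, i.e. $\theta\circ\psi\circ\theta=\psi\circ\theta\circ\psi$ for all congruences $\theta,\psi$ of any implication algebra, but it is not congruence permutable, i.e. $\theta\circ\psi=\psi\circ\theta$ fails for some congruences $\theta,\psi$ of some implication algebra. The functor $F_{\mathcal V}$ does not weakly preserve epi-pullbacks: there are surjective maps $\alpha:X\to Z$ and $\beta:Y\to Z$ such that $F_{\mathcal V}$ does not send a pullback square of $\alpha$ and $\beta$ to a weak pullback square (a commutative square through which every competing cone factors, not necessarily uniquely). -/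

import Mathlib

open CategoryTheory CategoryTheory.Limits

universe u v w

/-! ### Implication algebras -/

/-- An implication algebra (in the sense of Abbott): a set with a binary operation `x ⇨ y`
satisfying the three equations below. These equations, in the signature with the single binary
operation `⇨`, define the variety of implication algebras. -/
class ImplicationAlgebra (A : Type u) extends HImp A where
  /-- contraction -/
  imp_imp_self (x y : A) : (x ⇨ y) ⇨ x = x
  /-- quasi-commutativity -/
  imp_imp_comm (x y : A) : (x ⇨ y) ⇨ y = (y ⇨ x) ⇨ x
  /-- exchange -/
  imp_left_comm (x y z : A) : x ⇨ (y ⇨ z) = y ⇨ (x ⇨ z)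

/-- Homomorphisms of implication algebras. -/
structure ImplicationHom (A : Type u) (B : Type v)
    [ImplicationAlgebra A] [ImplicationAlgebra B] where
  /-- the underlying map -/
  toFun : A → B
  map_imp (x y : A) : toFun (x ⇨ y) = toFun x ⇨ toFun y

/-- Congruences of an implication algebra: equivalence relations compatible with `⇨`. -/
structure ImplicationCon (A : Type u) [ImplicationAlgebra A] extends Setoid A where
  imp {a b c d : A} : r a b → r c d → r (a ⇨ c) (b ⇨ d)

/-! ### Congruence `n`-permutability -/

/-- The alternating relational product `r ∘ s ∘ r ∘ ⋯` with `n` factors. -/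
def alternatingComp {A : Type u} (r s : A → A → Prop) : ℕ → (A → A → Prop)
  | 0 => Eq
  | n + 1 => Relation.Comp r (alternatingComp s r n)

/-- The variety of implication algebras is (congruence) `n`-permutable: for any two congruences
`θ, ψ` of any implication algebra one has `θ ∘ ψ ∘ θ ∘ ⋯ = ψ ∘ θ ∘ ψ ∘ ⋯`, with `n` factors on
both sides. For `n = 2` this is congruence permutability. -/
def ImplicationAlgebrasNPermutable (n : ℕ) : Prop :=
  ∀ (A : Type u) [ImplicationAlgebra A] (θ ψ : ImplicationCon A),
    alternatingComp θ.r ψ.r n = alternatingComp ψ.r θ.r n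

/-! ### Free implication algebras -/

/-- Terms in the variables `X` over one binary operation symbol. -/
inductive ImplicationTerm (X : Type u) : Type u
  | var (x : X) : ImplicationTerm X
  | imp (s t : ImplicationTerm X) : ImplicationTerm X

namespace ImplicationTerm

/-- The least congruence on terms that contains all instances of the three defining equations. -/
inductive Rel {X : Type u} : ImplicationTerm X → ImplicationTerm X → Prop
  | refl (s) : Rel s s
  | symm {s t} : Rel s t → Rel t s
  | trans {s t r} : Rel s t → Rel t r → Rel s r
  | congr {s s' t t'} : Rel s s' → Rel t t' → Rel (imp s t) (imp s' t')
  | imp_imp_self (x y) : Rel (imp (imp x y) x) x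
  | imp_imp_comm (x y) : Rel (imp (imp x y) y) (imp (imp y x) x)
  | imp_left_comm (x y z) : Rel (imp x (imp y z)) (imp y (imp x z))

/-- Provable equality of terms, as a setoid. -/
def setoid (X : Type u) : Setoid (ImplicationTerm X) where
  r := Rel
  iseqv := ⟨Rel.refl, Rel.symm, Rel.trans⟩

/-- The value of a term in an implication algebra under an assignment of the variables. -/
def eval {X : Type u} {A : Type v} [ImplicationAlgebra A] (φ : X → A) : ImplicationTerm X → A
  | var x => φ x
  | imp s t => eval φ s ⇨ eval φ t

theorem eval_eq_of_rel {X : Type u} {A : Type v} [ImplicationAlgebra A] (φ : X → A)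
    {s t : ImplicationTerm X} (h : Rel s t) : eval φ s = eval φ t := by
  induction h with
  | refl s => rfl
  | symm _ ih => exact ih.symm
  | trans _ _ ih₁ ih₂ => exact ih₁.trans ih₂
  | congr _ _ ih₁ ih₂ => simp only [eval, ih₁, ih₂]
  | imp_imp_self x y => exact ImplicationAlgebra.imp_imp_self _ _
  | imp_imp_comm x y => exact ImplicationAlgebra.imp_imp_comm _ _
  | imp_left_comm x y z => exact ImplicationAlgebra.imp_left_comm _ _ _

end ImplicationTerm

/-- The implication algebra freely generated by `X`. -/
def FreeImplicationAlgebra (X : Type u) : Type u := Quotient (ImplicationTerm.setoid X)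

namespace FreeImplicationAlgebra

instance (X : Type u) : ImplicationAlgebra (FreeImplicationAlgebra X) where
  himp := Quotient.map₂ ImplicationTerm.imp fun _ _ h₁ _ _ h₂ => ImplicationTerm.Rel.congr h₁ h₂
  imp_imp_self := by
    rintro ⟨x⟩ ⟨y⟩
    exact Quotient.sound (ImplicationTerm.Rel.imp_imp_self x y)
  imp_imp_comm := by
    rintro ⟨x⟩ ⟨y⟩
    exact Quotient.sound (ImplicationTerm.Rel.imp_imp_comm x y)
  imp_left_comm := by
    rintro ⟨x⟩ ⟨y⟩ ⟨z⟩
    exact Quotient.sound (ImplicationTerm.Rel.imp_left_comm x y z)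

/-- The inclusion of the variables. -/
def of {X : Type u} (x : X) : FreeImplicationAlgebra X := Quotient.mk _ (ImplicationTerm.var x)

/-- The homomorphic extension of a map from the variables to an implication algebra. -/
def lift {X : Type u} {A : Type v} [ImplicationAlgebra A] (φ : X → A) :
    ImplicationHom (FreeImplicationAlgebra X) A where
  toFun := Quotient.lift (ImplicationTerm.eval φ) fun _ _ h => ImplicationTerm.eval_eq_of_rel φ h
  map_imp := by
    rintro ⟨x⟩ ⟨y⟩
    rfl

theorem lift_of {X : Type u} {A : Type v} [ImplicationAlgebra A] (φ : X → A) (x : X) :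
    (lift φ).toFun (of x) = φ x := rfl

theorem hom_ext {X : Type u} {A : Type v} [ImplicationAlgebra A]
    {f g : ImplicationHom (FreeImplicationAlgebra X) A}
    (h : ∀ x, f.toFun (of x) = g.toFun (of x)) : f.toFun = g.toFun := by
  funext a
  obtain ⟨t⟩ := a
  induction t with
  | var x => exact h x
  | imp s t ihs iht =>
    exact (f.map_imp _ _).trans ((congrArg₂ (· ⇨ ·) ihs iht).trans (g.map_imp _ _).symm)

/-- The universal property of the free implication algebra. -/
theorem existsUnique_hom {X : Type u} {A : Type v} [ImplicationAlgebra A] (φ : X → A) :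
    ∃! f : ImplicationHom (FreeImplicationAlgebra X) A, ∀ x, f.toFun (of x) = φ x := by
  refine ⟨lift φ, lift_of φ, fun g hg => ?_⟩
  have h : g.toFun = (lift φ).toFun := hom_ext hg
  cases g
  cases h
  rfl

/-- The homomorphic extension of `of ∘ f`, as a map between free algebras. -/
def map {X : Type u} {Y : Type v} (f : X → Y) :
    FreeImplicationAlgebra X → FreeImplicationAlgebra Y :=
  (lift fun x => of (f x)).toFun

theorem map_id (X : Type u) : map (id : X → X) = id :=
  hom_ext (f := lift fun x => of x) (g := ⟨id, fun _ _ => rfl⟩) fun _ => rfl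

theorem map_comp {X : Type u} {Y : Type v} {Z : Type w} (g : Y → Z) (f : X → Y) :
    map (g ∘ f) = map g ∘ map f :=
  hom_ext (f := lift fun x => of (g (f x)))
    (g := ⟨map g ∘ map f, fun x y =>
      (congrArg (map g) ((lift fun x => of (f x)).map_imp x y)).trans
        ((lift fun y => of (g y)).map_imp _ _)⟩) fun _ => rfl

end FreeImplicationAlgebra

/-- The free-algebra functor of the variety of implication algebras, as a set functor. -/
def freeImplicationAlgebraFunctor : Type u ⥤ Type u where
  obj X := FreeImplicationAlgebra X
  map f := TypeCat.ofHom (FreeImplicationAlgebra.map f)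
  map_id X := by
    ext x
    exact congrFun (FreeImplicationAlgebra.map_id X) x
  map_comp f g := by
    ext x
    exact congrFun (FreeImplicationAlgebra.map_comp g f) x

/-! ### Weak preservation of epi-pullbacks -/

/-- The square with `fst ≫ f = snd ≫ g` is a weak pullback: it commutes, and every competitor
factors through it, not necessarily uniquely. -/
def IsWeakPullback {C : Type u} [Category.{v} C] {P X Y Z : C}
    (fst : P ⟶ X) (snd : P ⟶ Y) (f : X ⟶ Z) (g : Y ⟶ Z) : Prop :=
  ∃ h : fst ≫ f = snd ≫ g, Nonempty (IsWeakLimit (PullbackCone.mk fst snd h))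

/-- The set functor `F` weakly preserves epi-pullbacks: it sends the pullback square of any two
epimorphisms with a common codomain to a weak pullback square. -/
def WeaklyPreservesEpiPullbacks (F : Type u ⥤ Type u) : Prop :=
  ∀ ⦃P X Y Z : Type u⦄ (fst : P ⟶ X) (snd : P ⟶ Y) (f : X ⟶ Z) (g : Y ⟶ Z),
    Epi f → Epi g → IsPullback fst snd f g →
      IsWeakPullback (F.map fst) (F.map snd) (F.map f) (F.map g)

/-! The terms `p(x,y,z) = (z ⇨ y) ⇨ x` and `q(x,y,z) = (x ⇨ y) ⇨ z` satisfy `p(x,y,y) = x`,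
`p(x,x,z) = q(x,z,z)` and `q(x,x,z) = z`, which gives 3-permutability. Permutability fails on the
pairs of truth values other than (False, False), for the kernels of the two projections.

For the functor, let `f` identify `x, y` and let `g` identify `y, z`. The middle identity says that
`p` and `q` have the same image under `F f` and `F g`. A common preimage over the pullback would be
a 4-ary term `t` with `t(x,y,z,z) = p` and `t(x,x,y,z) = q`; then `m(x,y,z) = t(x,y,y,z)` satisfies
`m(x,y,y) = x` and `m(x,x,z) = z`, so congruences would permute. -/

namespace ImplicationAlgebra

variable {A : Type u} [ImplicationAlgebra A]

theorem imp_imp_left (x y : A) : x ⇨ (x ⇨ y) = x ⇨ y := by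
  have h := imp_imp_self (x ⇨ y) x
  rwa [imp_imp_self x y] at h

theorem imp_self_imp (x y : A) : (x ⇨ y) ⇨ (x ⇨ y) = x ⇨ x := by
  have h := imp_imp_comm (x ⇨ y) x
  rw [imp_imp_self, imp_imp_left] at h
  exact h.symm

/-- The element `x ⇨ x` does not depend on `x`. -/
theorem imp_self_eq_imp_self (x y : A) : x ⇨ x = y ⇨ y := by
  rw [← imp_self_imp x y, ← imp_self_imp (x ⇨ y) y, imp_imp_comm x y, imp_self_imp, imp_self_imp]

theorem imp_self_imp_eq (x y : A) : (x ⇨ x) ⇨ y = y := by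
  rw [imp_self_eq_imp_self x y, imp_imp_self]

end ImplicationAlgebra

/-! ### Congruence 3-permutability -/

namespace ImplicationCon

variable {A : Type u} [ImplicationAlgebra A]

/-- One inclusion of `3`-permutability, from the Hagemann–Mitschke terms `(z ⇨ y) ⇨ x` and
`(x ⇨ y) ⇨ z`. -/
theorem exists_of_three (θ ψ : ImplicationCon A) {a b c d : A}
    (hab : θ.r a b) (hbc : ψ.r b c) (hcd : θ.r c d) :
    ∃ e f, ψ.r a e ∧ θ.r e f ∧ ψ.r f d := by
  refine ⟨(c ⇨ b) ⇨ a, (b ⇨ c) ⇨ d, ?_, ?_, ?_⟩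
  · have h := ψ.imp (ψ.imp hbc (ψ.iseqv.refl b)) (ψ.iseqv.refl a)
    rwa [ImplicationAlgebra.imp_self_imp_eq] at h
  -- Modulo `θ` the two witnesses become `(d ⇨ a) ⇨ a` and `(a ⇨ d) ⇨ d`, which agree by
  -- quasi-commutativity.
  · have h₁ := θ.imp (θ.imp hcd (θ.iseqv.symm hab)) (θ.iseqv.refl a)
    have h₂ := θ.imp (θ.imp hab (θ.iseqv.symm hcd)) (θ.iseqv.refl d)
    rw [ImplicationAlgebra.imp_imp_comm] at h₁
    exact θ.iseqv.trans h₁ h₂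
  · have h := ψ.imp (ψ.imp hbc (ψ.iseqv.refl c)) (ψ.iseqv.refl d)
    rwa [ImplicationAlgebra.imp_self_imp_eq] at h

/-- The kernel of a homomorphism. -/
def ker {B : Type v} [ImplicationAlgebra B] (f : ImplicationHom A B) : ImplicationCon A where
  r a b := f.toFun a = f.toFun b
  iseqv := ⟨fun _ => rfl, Eq.symm, Eq.trans⟩
  imp h₁ h₂ := by rw [f.map_imp, f.map_imp, h₁, h₂]

end ImplicationCon

theorem alternatingComp_two {A : Type u} {r s : A → A → Prop} {a b : A} :
    alternatingComp r s 2 a b ↔ ∃ c, r a c ∧ s c b := by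
  simp [alternatingComp, Relation.Comp]

theorem alternatingComp_three {A : Type u} {r s : A → A → Prop} {a b : A} :
    alternatingComp r s 3 a b ↔ ∃ c d, r a c ∧ s c d ∧ r d b := by
  simp [alternatingComp, Relation.Comp]

theorem implicationAlgebrasNPermutable_three : ImplicationAlgebrasNPermutable.{u} 3 := by
  have key : ∀ (A : Type u) [ImplicationAlgebra A] (θ ψ : ImplicationCon A) (a d : A),
      alternatingComp θ.r ψ.r 3 a d → alternatingComp ψ.r θ.r 3 a d := by
    intro A _ θ ψ a d h
    obtain ⟨b, c, hab, hbc, hcd⟩ := alternatingComp_three.1 h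
    exact alternatingComp_three.2 (ImplicationCon.exists_of_three θ ψ hab hbc hcd)
  intro A _ θ ψ
  funext a d
  exact propext ⟨key A θ ψ a d, key A ψ θ a d⟩

/-! ### Failure of congruence permutability -/

/-- The implication algebra of the truth values. -/
instance Prop.implicationAlgebra : ImplicationAlgebra Prop where
  imp_imp_self x y := propext (by change ((x → y) → x) ↔ x; tauto)
  imp_imp_comm x y := propext (by change ((x → y) → y) ↔ ((y → x) → x); tauto)
  imp_left_comm x y z := propext (by change (x → y → z) ↔ (y → x → z); tauto)

/-- The implication algebra of the pairs of truth values at least one of which is true. -/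
def TruePair : Type u := ULift.{u} {p : Prop × Prop // p.1 ∨ p.2}

namespace TruePair

instance : ImplicationAlgebra TruePair.{u} where
  himp x y := ⟨(x.down.1.1 ⇨ y.down.1.1, x.down.1.2 ⇨ y.down.1.2),
    y.down.2.imp (fun h _ => h) (fun h _ => h)⟩
  imp_imp_self _ _ := ULift.ext _ _ (Subtype.ext (Prod.ext
    (ImplicationAlgebra.imp_imp_self (A := Prop) _ _)
    (ImplicationAlgebra.imp_imp_self (A := Prop) _ _)))
  imp_imp_comm _ _ := ULift.ext _ _ (Subtype.ext (Prod.ext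
    (ImplicationAlgebra.imp_imp_comm (A := Prop) _ _)
    (ImplicationAlgebra.imp_imp_comm (A := Prop) _ _)))
  imp_left_comm _ _ _ := ULift.ext _ _ (Subtype.ext (Prod.ext
    (ImplicationAlgebra.imp_left_comm (A := Prop) _ _ _)
    (ImplicationAlgebra.imp_left_comm (A := Prop) _ _ _)))

/-- The first projection. -/
def fst : ImplicationHom TruePair.{u} Prop := ⟨fun x => x.down.1.1, fun _ _ => rfl⟩

/-- The second projection. -/
def snd : ImplicationHom TruePair.{u} Prop := ⟨fun x => x.down.1.2, fun _ _ => rfl⟩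

end TruePair

theorem not_implicationAlgebrasNPermutable_two : ¬ ImplicationAlgebrasNPermutable.{u} 2 := by
  intro h
  have h' := h TruePair (ImplicationCon.ker TruePair.fst) (ImplicationCon.ker TruePair.snd)
  have h₁ : alternatingComp (ImplicationCon.ker TruePair.fst.{u}).r
      (ImplicationCon.ker TruePair.snd).r 2
      ⟨⟨(True, False), Or.inl trivial⟩⟩ ⟨⟨(False, True), Or.inr trivial⟩⟩ :=
    alternatingComp_two.2 ⟨⟨⟨(True, True), Or.inl trivial⟩⟩, rfl, rfl⟩
  rw [h'] at h₁
  -- In the other order the intermediate point would have to be (False, False), the excluded pair.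
  obtain ⟨c, hc₁, hc₂⟩ := alternatingComp_two.1 h₁
  have hc₁' : False = c.down.1.2 := hc₁
  have hc₂' : c.down.1.1 = False := hc₂
  have := c.down.2
  rw [← hc₁', hc₂'] at this
  simp at this

/-! ### Failure of weak preservation of epi-pullbacks -/

namespace FreeImplicationAlgebra

/-- Term operations respect congruences. This allows `t` to be evaluated modulo one congruence at a
time. -/
theorem lift_rel_lift {X : Type u} {A : Type v} [ImplicationAlgebra A] (θ : ImplicationCon A)
    {φ φ' : X → A} (h : ∀ x, θ.r (φ x) (φ' x)) (t : FreeImplicationAlgebra X) :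
    θ.r ((lift φ).toFun t) ((lift φ').toFun t) := by
  obtain ⟨t⟩ := t
  induction t with
  | var x => exact h x
  | imp s t ihs iht => exact θ.imp ihs iht

theorem lift_map {X : Type u} {Y : Type v} {A : Type w} [ImplicationAlgebra A]
    (φ : Y → A) (f : X → Y) (t : FreeImplicationAlgebra X) :
    (lift φ).toFun (map f t) = (lift (φ ∘ f)).toFun t := by
  obtain ⟨t⟩ := t
  induction t with
  | var x => rfl
  | imp s t ihs iht =>
    exact (congrArg (lift φ).toFun ((lift fun x => of (f x)).map_imp _ _)).trans
      (((lift φ).map_imp _ _).trans (congrArg₂ (· ⇨ ·) ihs iht))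

end FreeImplicationAlgebra

theorem IsWeakPullback.exists_eq_eq {P X Y Z : Type u} {fst : P ⟶ X} {snd : P ⟶ Y} {f : X ⟶ Z}
    {g : Y ⟶ Z} (h : IsWeakPullback fst snd f g) {x : X} {y : Y} (hxy : f x = g y) :
    ∃ p, fst p = x ∧ snd p = y := by
  obtain ⟨w, ⟨hw⟩⟩ := h
  -- A compatible pair of elements is a cone with a one-point vertex.
  let s : PullbackCone f g := PullbackCone.mk (W := PUnit.{u + 1})
    (TypeCat.ofHom fun _ => x) (TypeCat.ofHom fun _ => y) (by ext; exact hxy)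
  refine ⟨hw.lift s PUnit.unit, ?_, ?_⟩
  · exact ConcreteCategory.congr_hom (hw.fac s WalkingCospan.left) PUnit.unit
  · exact ConcreteCategory.congr_hom (hw.fac s WalkingCospan.right) PUnit.unit

/-- An element of the free algebra over the pullback of the two monotone surjections of the
three-element chain onto the two-element chain that is mapped to the Hagemann–Mitschke terms
`(z ⇨ y) ⇨ x` and `(x ⇨ y) ⇨ z` yields a Maltsev term. -/
theorem implicationAlgebrasNPermutable_two_of_weaklyPreservesEpiPullbacks
    (h : WeaklyPreservesEpiPullbacks freeImplicationAlgebraFunctor.{u}) :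
    ImplicationAlgebrasNPermutable.{u} 2 := by
  open FreeImplicationAlgebra in
  let x : ULift.{u} (Fin 3) := ⟨0⟩
  let y : ULift.{u} (Fin 3) := ⟨1⟩
  let z : ULift.{u} (Fin 3) := ⟨2⟩
  -- The pullback of `f` and `g` consists of the four pairs `(x,x)`, `(y,x)`, `(z,y)`, `(z,z)`.
  let f : ULift.{u} (Fin 3) ⟶ ULift.{u} Bool := TypeCat.ofHom fun i => ⟨decide (i.down = 2)⟩
  let g : ULift.{u} (Fin 3) ⟶ ULift.{u} Bool := TypeCat.ofHom fun i => ⟨decide (i.down ≠ 0)⟩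
  have hf : Epi f := (epi_iff_surjective f).2 (by
    rintro ⟨_ | _⟩
    exacts [⟨x, rfl⟩, ⟨z, rfl⟩])
  have hg : Epi g := (epi_iff_surjective g).2 (by
    rintro ⟨_ | _⟩
    exacts [⟨x, rfl⟩, ⟨z, rfl⟩])
  have hP := IsPullback.of_hasPullback f g
  have hw := h _ _ f g hf hg hP
  obtain ⟨t, ht₁, ht₂⟩ := hw.exists_eq_eq (x := ((of z ⇨ of y) ⇨ of x : FreeImplicationAlgebra (ULift.{u} (Fin 3))))
    (y := ((of x ⇨ of y) ⇨ of z : FreeImplicationAlgebra (ULift.{u} (Fin 3))))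
    (ImplicationAlgebra.imp_imp_comm (of _) (of _))
  have key : ∀ (A : Type u) [ImplicationAlgebra A] (θ ψ : ImplicationCon A) (a c : A),
      alternatingComp θ.r ψ.r 2 a c → alternatingComp ψ.r θ.r 2 a c := by
    intro A _ θ ψ a c hac
    obtain ⟨b, hab, hbc⟩ := alternatingComp_two.1 hac
    let φ : ULift.{u} (Fin 3) → A := fun i => ![a, b, c] i.down
    -- On `(x,x)`, `(y,x)`, `(z,y)`, `(z,z)` the values are `a, b, b, c`. So `χ` differs from `φ ∘
    -- fst` only at `(z,y)`, by `b` against `c`, and from `φ ∘ snd` only at `(y,x)`, by `b` against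
    -- `a`.
    let χ : ↑(pullback f g) → A := fun p =>
      if (pullback.snd f g p).down = 0 then φ (pullback.fst f g p) else φ (pullback.snd f g p)
    have hp : ∀ p,
        decide ((pullback.fst f g p).down = 2) = decide ((pullback.snd f g p).down ≠ 0) :=
      fun p => congrArg ULift.down (ConcreteCategory.congr_hom hP.w p)
    refine alternatingComp_two.2 ⟨(lift χ).toFun t, ?_, ?_⟩
    · have h₁ := lift_rel_lift ψ (φ := χ) (φ' := φ ∘ pullback.fst f g) (fun p => by
        have hp' := hp p
        simp only [χ, φ, Function.comp]
        generalize (pullback.fst f g p).down = i at hp' ⊢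
        generalize (pullback.snd f g p).down = j at hp' ⊢
        fin_cases i <;> fin_cases j <;>
          first
          | exact absurd hp' (by decide)
          | exact ψ.iseqv.refl _
          | exact hbc) t
      have e : (lift (φ ∘ pullback.fst f g)).toFun t = (c ⇨ b) ⇨ a :=
        (lift_map φ (pullback.fst f g) t).symm.trans (congrArg (lift φ).toFun ht₁)
      rw [e] at h₁
      have h₂ : ψ.r ((c ⇨ b) ⇨ a) ((b ⇨ b) ⇨ a) :=
        ψ.imp (ψ.imp (ψ.iseqv.symm hbc) (ψ.iseqv.refl b)) (ψ.iseqv.refl a)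
      rw [ImplicationAlgebra.imp_self_imp_eq] at h₂
      exact ψ.iseqv.symm (ψ.iseqv.trans h₁ h₂)
    · have h₁ := lift_rel_lift θ (φ := χ) (φ' := φ ∘ pullback.snd f g) (fun p => by
        have hp' := hp p
        simp only [χ, φ, Function.comp]
        generalize (pullback.fst f g p).down = i at hp' ⊢
        generalize (pullback.snd f g p).down = j at hp' ⊢
        fin_cases i <;> fin_cases j <;>
          first
          | exact absurd hp' (by decide)
          | exact θ.iseqv.refl _
          | exact θ.iseqv.symm hab) t
      have e : (lift (φ ∘ pullback.snd f g)).toFun t = (a ⇨ b) ⇨ c :=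
        (lift_map φ (pullback.snd f g) t).symm.trans (congrArg (lift φ).toFun ht₂)
      rw [e] at h₁
      have h₂ : θ.r ((a ⇨ b) ⇨ c) ((b ⇨ b) ⇨ c) :=
        θ.imp (θ.imp hab (θ.iseqv.refl b)) (θ.iseqv.refl c)
      rw [ImplicationAlgebra.imp_self_imp_eq] at h₂
      exact θ.iseqv.trans h₁ h₂
  intro A _ θ ψ
  funext a c
  exact propext ⟨key A θ ψ a c, key A ψ θ a c⟩

theorem mainTheorem6 :
    ImplicationAlgebrasNPermutable.{u} 3 ∧
    ¬ ImplicationAlgebrasNPermutable.{u} 2 ∧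
    ¬ WeaklyPreservesEpiPullbacks freeImplicationAlgebraFunctor.{u} :=
  ⟨implicationAlgebrasNPermutable_three, not_implicationAlgebrasNPermutable_two,
    fun h => not_implicationAlgebrasNPermutable_two
      (implicationAlgebrasNPermutable_two_of_weaklyPreservesEpiPullbacks h)⟩
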